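/- Setting. Let $d\ge 0$. In the classical case let $(\mathcal S,\mu)$ be a probability space, and for finite $X\subset\mathbb Z^d$ put $\mathcal S_X=\mathcal S^X$. In the quantum case let $\mathcal H\neq 0$ be a finite-dimensional complex Hilbert space, and put $\mathcal H_X=\bigotimes_{i\in X}\mathcal H$. A random potential $U=U(J,\Phi)$ consists of the following, for every finite $X\subset\mathbb Z^d$: - a finite label set $n_X$; - for each $j\in n_X$, a real random variable $J^{(j)}_X$; - for each $j\in n_X$, in the classical case a bounded $\mu^{|X|}$-measurable function $\Phi^{(j)}_X:\mathcal S_X\to\mathbb R$, and in the quantum case a self-adjoint operator $\Phi^{(j)}_X$ on $\mathcal H_X$. We require $\Phi^{(j)}_\emptyset=0$; that the $J^{(j)}_X$ are independent; and translation invariance: for all $a\in\mathbb Z^d$, $n_{X+a}=n_X$, $\Phi^{(j)}_{X+a}$ is the translate of $\Phi^{(j)}_X$, and $J^{(j)}_{X+a}$ has the same distribution as $J^{(j)}_X$. All random variables live on one probability space, with expectation $\mathrm{Av}[\cdot]$. For finite $\Lambda\subset\mathbb Z^d$ let $$U_\Lambda=\sum_{X\subset\Lambda}\sum_{j\in n_X}J^{(j)}_X\Phi^{(j)}_X,\qquad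 Z_\Lambda=\mathrm{Tr}\,e^{U_\Lambda},\qquad P_\Lambda=\mathrm{Av}[\ln Z_\Lambda],$$ and, for $\Lambda\ne\emptyset$, $p_\Lambda=P_\Lambda/|\Lambda|$. Here $\mathrm{Tr}$ is the expectation with respect to the product measure $\mu^{|\Lambda|}$ on $\mathcal S_\Lambda$ in the classical case, and the usual trace on $\mathcal H_\Lambda$ in the quantum case (where $\Phi^{(j)}_X$ acts on $\mathcal H_\Lambda$ as $\Phi^{(j)}_X\otimes 1$). With $\|\Phi^{(j)}_X\|$ the supremum norm (classical) or the operator norm (quantum), put $$\|U\|_1=\sum_{X\ni 0}\sum_{j\in n_X}\frac{\mathrm{Av}[|J^{(j)}_X|]\,\|\Phi^{(j)}_X\|}{|X|},\qquad \|U\|_2=\Big(\sum_{X\ni 0}\sum_{j\in n_X}\frac{\mathrm{Av}[|J^{(j)}_X|^2]\,\|\Phi^{(j)}_X\|^2}{|X|}\Big)^{1/2}.$$ Theorem. Suppose that the random potential $U$ is stable, that is, $U_\Lambda=\tilde U_\Lambda+\hat U_\Lambda$ for all finite $\Lambda$ (almost surely), where $\tilde U=\tilde U(\tilde J,\tilde\Phi)$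 and $\hat U=\hat U(\hat J,\hat\Phi)$ are random potentials such that all the $\tilde J^{(j)}_X$ and $\hat J^{(j)}_X$ together are independent, the $\hat J^{(j)}_X$ have zero mean, $\|\tilde U\|_1<\infty$ and $\|\hat U\|_2<\infty$. Then for every finite $\Lambda\subset\mathbb Z^d$, with $N=|\Lambda|$, $\ln Z_\Lambda$ is integrable (so that $P_\Lambda$ is well defined), and $$P_\Lambda\le N\big(\|\tilde U\|_1+4\|\hat U\|_2^2\big)\ \text{ in the classical case},$$ $$P_\Lambda\le N\big(\ln\dim\mathcal H+\|\tilde U\|_1+4\|\hat U\|_2^2\big)\ \text{ in the quantum case}.$$ Moreover, in both cases the quenched specific pressure is bounded: there is a constant $C$ with $|p_\Lambda|\le C$ for all non-empty finite $\Lambda\subset\mathbb Z^d$. -/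

import Mathlib

open MeasureTheory ProbabilityTheory
open scoped ENNReal

/-! ### The lattice, and random couplings -/

/-- The sites of the lattice `ℤ^d`. -/
abbrev Site (d : ℕ) : Type := Fin d → ℤ

/-- The translate `τ_a X = a + X` of a finite set of sites. -/
def translateSet {d : ℕ} (a : Site d) (X : Finset (Site d)) : Finset (Site d) :=
  X.map (addLeftEmbedding a)

/-- The configuration on `X` obtained from a configuration `s` on `τ_a X`:
its value at `i` is `s (a + i)`. -/
def pullback {d : ℕ} {α : Type*} (a : Site d) (X : Finset (Site d))
    (s : translateSet a X → α) : X → α :=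
  fun i => s ⟨a + i.1, Finset.mem_map_of_mem (addLeftEmbedding a) i.2⟩

/-- Translation invariant random couplings on the probability space `(Ω, Pr)`: for each finite set
`X` of sites a finite set `n X` of labels and, for `j ∈ n X`, a real random variable `J X j`.
The values `J X j` for `j ∉ n X` play no role. -/
structure Couplings (d : ℕ) (ι : Type*) {Ω : Type*} [MeasurableSpace Ω] (Pr : Measure Ω) where
  /-- The finite label sets. -/
  n : Finset (Site d) → Finset ι
  n_translate : ∀ (a : Site d) (X : Finset (Site d)), n (translateSet a X) = n X
  /-- The coupling coefficients. -/
  J : Finset (Site d) → ι → Ω → ℝ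
  measurable_J : ∀ X, ∀ j ∈ n X, Measurable (J X j)
  indep_J : iIndepFun (fun p : (Σ X : Finset (Site d), {j : ι // j ∈ n X}) => J p.1 p.2.1) Pr
  identDistrib_J : ∀ (a : Site d) (X : Finset (Site d)), ∀ j ∈ n X,
    IdentDistrib (J (translateSet a X) j) (J X j) Pr Pr

namespace Couplings

variable {d : ℕ} {ι : Type*} {Ω : Type*} [MeasurableSpace Ω] {Pr : Measure Ω}

/-- The index set of the couplings: all pairs `(X, j)` with `j ∈ n X`. -/
abbrev Index (c : Couplings d ι Pr) : Type _ :=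
  Σ X : Finset (Site d), {j : ι // j ∈ c.n X}

/-- `∑_{X ∋ 0} ∑_{j ∈ n X} Av[|J X j|] ‖Φ X j‖ / |X|`, the numbers `‖Φ X j‖` being given by `w`. -/
noncomputable def weightedNorm1 (c : Couplings d ι Pr)
    (w : Finset (Site d) → ι → ℝ≥0∞) : ℝ≥0∞ :=
  ∑' X : {X : Finset (Site d) // (0 : Site d) ∈ X}, ∑ j ∈ c.n X.1,
    (∫⁻ ω, ‖c.J X.1 j ω‖ₑ ∂Pr) * w X.1 j / (X.1.card : ℝ≥0∞)

/-- `(∑_{X ∋ 0} ∑_{j ∈ n X} Av[|J X j|^2] ‖Φ X j‖^2 / |X|)^(1/2)`, the numbers `‖Φ X j‖` being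
given by `w`. -/
noncomputable def weightedNorm2 (c : Couplings d ι Pr)
    (w : Finset (Site d) → ι → ℝ≥0∞) : ℝ≥0∞ :=
  (∑' X : {X : Finset (Site d) // (0 : Site d) ∈ X}, ∑ j ∈ c.n X.1,
    (∫⁻ ω, ‖c.J X.1 j ω‖ₑ ^ 2 ∂Pr) * w X.1 j ^ 2 / (X.1.card : ℝ≥0∞)) ^ (1 / 2 : ℝ)

/-- All the couplings have zero mean. -/
def ZeroMean (c : Couplings d ι Pr) : Prop :=
  ∀ X, ∀ j ∈ c.n X, Integrable (c.J X j) Pr ∧ ∫ ω, c.J X j ω ∂Pr = 0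

/-- All the couplings of two families are (jointly) independent. -/
def JointlyIndep {ι' : Type*} (c : Couplings d ι Pr) (c' : Couplings d ι' Pr) : Prop :=
  iIndepFun (fun p : c.Index ⊕ c'.Index =>
    Sum.elim (fun q => c.J q.1 q.2.1) (fun q => c'.J q.1 q.2.1) p) Pr

end Couplings

/-! ### Classical random potentials -/

/-- A classical random potential with spin space `(S, μ)`: random couplings together with bounded
functions `Φ X j : S^X → ℝ`, measurable with respect to the product measure `μ^{|X|}`, and
translation invariant. -/
structure ClassicalPotential (d : ℕ) {S : Type*} [MeasurableSpace S] (μ : Measure S)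
    (ι : Type*) {Ω : Type*} [MeasurableSpace Ω] (Pr : Measure Ω) extends Couplings d ι Pr where
  /-- The interaction. -/
  Φ : (X : Finset (Site d)) → ι → (X → S) → ℝ
  aemeasurable_Φ : ∀ X, ∀ j ∈ n X, AEMeasurable (Φ X j) (Measure.pi fun _ : X => μ)
  bounded_Φ : ∀ X, ∀ j ∈ n X, ∃ C : ℝ, ∀ σ, |Φ X j σ| ≤ C
  Φ_empty : ∀ j ∈ n ∅, Φ ∅ j = 0
  Φ_translate : ∀ (a : Site d) (X : Finset (Site d)), ∀ j ∈ n X,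
    Φ (translateSet a X) j = fun σ => Φ X j (pullback a X σ)

namespace ClassicalPotential

variable {d : ℕ} {S : Type*} [MeasurableSpace S] {μ : Measure S} {ι : Type*} {Ω : Type*}
  [MeasurableSpace Ω] {Pr : Measure Ω}

/-- The random potential `U_Λ = ∑_{X ⊆ Λ} ∑_{j ∈ n X} J X j * Φ X j`, a function on `S^Λ`. -/
noncomputable def potential (U : ClassicalPotential d μ ι Pr) (Λ : Finset (Site d)) (ω : Ω)
    (σ : Λ → S) : ℝ :=
  ∑ X ∈ Λ.powerset.attach, ∑ j ∈ U.n X.1,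
    U.J X.1 j ω * U.Φ X.1 j (Finset.restrict₂ (π := fun _ => S) (Finset.mem_powerset.1 X.2) σ)

/-- The random partition function `Z_Λ = Tr exp U_Λ`, where `Tr` is the expectation over `S^Λ`
with respect to the product measure. -/
noncomputable def partitionFunction (U : ClassicalPotential d μ ι Pr) (Λ : Finset (Site d))
    (ω : Ω) : ℝ :=
  ∫ σ, Real.exp (U.potential Λ ω σ) ∂(Measure.pi fun _ : Λ => μ)

/-- The quenched pressure `P_Λ = Av[log Z_Λ]`. -/
noncomputable def pressure (U : ClassicalPotential d μ ι Pr) (Λ : Finset (Site d)) : ℝ :=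
  ∫ ω, Real.log (U.partitionFunction Λ ω) ∂Pr

/-- The quenched specific pressure `p_Λ = P_Λ / |Λ|`. -/
noncomputable def specificPressure (U : ClassicalPotential d μ ι Pr) (Λ : Finset (Site d)) : ℝ :=
  U.pressure Λ / (Λ.card : ℝ)

/-- The supremum norm `‖Φ X j‖`. -/
noncomputable def normΦ (U : ClassicalPotential d μ ι Pr) (X : Finset (Site d)) (j : ι) : ℝ≥0∞ :=
  ⨆ σ, ‖U.Φ X j σ‖ₑ

/-- `‖U‖₁`. -/
noncomputable def norm1 (U : ClassicalPotential d μ ι Pr) : ℝ≥0∞ :=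
  U.weightedNorm1 U.normΦ

/-- `‖U‖₂`. -/
noncomputable def norm2 (U : ClassicalPotential d μ ι Pr) : ℝ≥0∞ :=
  U.weightedNorm2 U.normΦ

/-- `U = Ut + Uh` is a decomposition which witnesses that the random potential `U` is stable. -/
structure IsStableDecomposition {ι₁ ι₂ : Type*} (U : ClassicalPotential d μ ι Pr)
    (Ut : ClassicalPotential d μ ι₁ Pr) (Uh : ClassicalPotential d μ ι₂ Pr) : Prop where
  eq_add : ∀ Λ : Finset (Site d), ∀ᵐ ω ∂Pr, ∀ σ : Λ → S,
    U.potential Λ ω σ = Ut.potential Λ ω σ + Uh.potential Λ ω σ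
  indep : Ut.JointlyIndep Uh.toCouplings
  zeroMean : Uh.ZeroMean
  norm1_lt_top : Ut.norm1 < ∞
  norm2_lt_top : Uh.norm2 < ∞

end ClassicalPotential

/-! ### Quantum random potentials

The one-site Hilbert space is `ℋ = ℂ^κ`, `κ` being a finite set that indexes an orthonormal basis.
Then `ℋ_X = ⨂_{i ∈ X} ℋ` is `ℂ^(X → κ)` (the configurations `X → κ` index the product basis), and
operators on it are matrices indexed by `X → κ`. -/

/-- The operators on `ℋ_X = ⨂_{i ∈ X} ℋ`. -/
abbrev LocalOperator {d : ℕ} (κ : Type*) (X : Finset (Site d)) : Type _ :=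
  Matrix (X → κ) (X → κ) ℂ

/-- For `X ⊆ Λ`, an operator `A` on `ℋ_X` regarded as the operator `A ⊗ 1` on
`ℋ_Λ = ℋ_X ⊗ ℋ_{Λ ∖ X}`. -/
def LocalOperator.extend {d : ℕ} {κ : Type*} [DecidableEq κ] {X Λ : Finset (Site d)} (h : X ⊆ Λ)
    (A : LocalOperator κ X) : LocalOperator κ Λ :=
  Matrix.of fun s t =>
    if ∀ i : Λ, i.1 ∉ X → s i = t i then
      A (Finset.restrict₂ (π := fun _ => κ) h s) (Finset.restrict₂ (π := fun _ => κ) h t)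
    else 0

/-- A quantum random potential with one-site Hilbert space `ℂ^κ`: random couplings together with
self-adjoint operators `Φ X j` on `ℋ_X`, translation invariant. -/
structure QuantumPotential (d : ℕ) (κ : Type*) [Fintype κ] [DecidableEq κ]
    (ι : Type*) {Ω : Type*} [MeasurableSpace Ω] (Pr : Measure Ω) extends Couplings d ι Pr where
  /-- The interaction. -/
  Φ : (X : Finset (Site d)) → ι → LocalOperator κ X
  isHermitian_Φ : ∀ X, ∀ j ∈ n X, (Φ X j).IsHermitian
  Φ_empty : ∀ j ∈ n ∅, Φ ∅ j = 0
  Φ_translate : ∀ (a : Site d) (X : Finset (Site d)), ∀ j ∈ n X,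
    Φ (translateSet a X) j = (Φ X j).submatrix (pullback a X) (pullback a X)

namespace QuantumPotential

variable {d : ℕ} {κ : Type*} [Fintype κ] [DecidableEq κ] {ι : Type*} {Ω : Type*}
  [MeasurableSpace Ω] {Pr : Measure Ω}

/-- The random potential `U_Λ = ∑_{X ⊆ Λ} ∑_{j ∈ n X} J X j • Φ X j`, an operator on `ℋ_Λ`. -/
noncomputable def potential (U : QuantumPotential d κ ι Pr) (Λ : Finset (Site d)) (ω : Ω) :
    LocalOperator κ Λ :=
  ∑ X ∈ Λ.powerset.attach, ∑ j ∈ U.n X.1,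
    (U.J X.1 j ω : ℂ) • (U.Φ X.1 j).extend (Finset.mem_powerset.1 X.2)

/-- The random partition function `Z_Λ = Tr exp U_Λ` (a real number, as `U_Λ` is self-adjoint). -/
noncomputable def partitionFunction (U : QuantumPotential d κ ι Pr) (Λ : Finset (Site d))
    (ω : Ω) : ℝ :=
  (Matrix.trace (NormedSpace.exp (U.potential Λ ω))).re

/-- The quenched pressure `P_Λ = Av[log Z_Λ]`. -/
noncomputable def pressure (U : QuantumPotential d κ ι Pr) (Λ : Finset (Site d)) : ℝ :=
  ∫ ω, Real.log (U.partitionFunction Λ ω) ∂Pr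

/-- The quenched specific pressure `p_Λ = P_Λ / |Λ|`. -/
noncomputable def specificPressure (U : QuantumPotential d κ ι Pr) (Λ : Finset (Site d)) : ℝ :=
  U.pressure Λ / (Λ.card : ℝ)

/-- The operator norm `‖Φ X j‖` on the Hilbert space `ℋ_X`. -/
noncomputable def normΦ (U : QuantumPotential d κ ι Pr) (X : Finset (Site d)) (j : ι) : ℝ≥0∞ :=
  ‖Matrix.toEuclideanCLM (n := X → κ) (𝕜 := ℂ) (U.Φ X j)‖ₑ

/-- `‖U‖₁`. -/
noncomputable def norm1 (U : QuantumPotential d κ ι Pr) : ℝ≥0∞ :=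
  U.weightedNorm1 U.normΦ

/-- `‖U‖₂`. -/
noncomputable def norm2 (U : QuantumPotential d κ ι Pr) : ℝ≥0∞ :=
  U.weightedNorm2 U.normΦ

/-- `U = Ut + Uh` is a decomposition which witnesses that the random potential `U` is stable. -/
structure IsStableDecomposition {ι₁ ι₂ : Type*} (U : QuantumPotential d κ ι Pr)
    (Ut : QuantumPotential d κ ι₁ Pr) (Uh : QuantumPotential d κ ι₂ Pr) : Prop where
  eq_add : ∀ Λ : Finset (Site d), ∀ᵐ ω ∂Pr,
    U.potential Λ ω = Ut.potential Λ ω + Uh.potential Λ ω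
  indep : Ut.JointlyIndep Uh.toCouplings
  zeroMean : Uh.ZeroMean
  norm1_lt_top : Ut.norm1 < ∞
  norm2_lt_top : Uh.norm2 < ∞

end QuantumPotential

/-! Let `f` be the logarithm of the partition function in `Λ`, as a function of the real couplings
of `Ut` and `Uh` in `Λ`. Along each coordinate it is convex; its slope is the Gibbs expectation of
the interaction term, hence at most the norm `M k` of that term, and its excess over the tangent
line is a variance effect of order `x² M k²`. These facts, recorded as `HasQuadraticSlopes`, are all
that the probabilistic part uses.

If a centred coupling `J k` is switched on while the other active couplings are independent of it,
the first-order term `J k * slope` has mean zero. By convexity the mean of `f` does not decrease,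
and it grows by at most `4 M k² Av[J k²]`. For couplings that need not be centred, the Lipschitz
bound costs `M t Av|J t|` in either direction (`HasQuadraticSlopes.integral_bounds`). Translation
invariance turns the sums of these costs over the subsets of `Λ` into `|Λ|` times `‖Ut‖₁` and
`‖Uh‖₂²` (`sum_powerset_le`). The starting value `f 0 = log Tr 1` is `0` or `|Λ| log dim ℋ`. The
upper bound on the pressure and a matching extensive lower bound follow together.

The slope estimates are model dependent. Classically they are Jensen's inequality and Hoeffding's
lemma under the Gibbs measure (`exists_slope_log_integral_exp`). In the quantum case, where the
terms need not commute, the spectra before and after the perturbation are coupled by the squared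
overlaps of their eigenvectors, a doubly stochastic matrix (`log_sum_exp_bounds`,
`exists_slope_log_trace_exp`). The constant 4 leaves room: the estimates give 1/2 and 1. -/

/-! ### Functions with quadratically controlled slopes -/

/-- In each coordinate direction `k`, the function `f` lies above a line of slope at most `M k` and
below that line plus the parabola `4 M_k² x²`. -/
def HasQuadraticSlopes {T : Type*} [DecidableEq T] (f : (T → ℝ) → ℝ) (M : T → ℝ) : Prop :=
  ∀ y k, ∃ g : ℝ, |g| ≤ M k ∧ ∀ x : ℝ, f y + x * g ≤ f (y + Pi.single k x) ∧
    f (y + Pi.single k x) ≤ f y + x * g + 4 * x ^ 2 * M k ^ 2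

namespace HasQuadraticSlopes

variable {T : Type*} [DecidableEq T] {f : (T → ℝ) → ℝ} {M : T → ℝ}

/-- Only the lower line matters: applied at `y` it limits the decrease, and applied at the shifted
point with step `-x` it limits the increase. -/
lemma abs_single_sub_le (h : HasQuadraticSlopes f M) (y : T → ℝ) (k : T) (x : ℝ) :
    |f (y + Pi.single k x) - f y| ≤ M k * |x| := by
  have key : ∀ (z : T → ℝ) (x : ℝ), f z - M k * |x| ≤ f (z + Pi.single k x) := by
    intro z x
    obtain ⟨g, hg, hgx⟩ := h z k
    have h1 : |x * g| ≤ M k * |x| := by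
      rw [abs_mul, mul_comm]
      exact mul_le_mul_of_nonneg_right hg (abs_nonneg x)
    linarith [(hgx x).1, (abs_le.1 h1).1]
  have h1 := key y x
  have h2 := key (y + Pi.single k x) (-x)
  rw [add_assoc, ← Pi.single_add, add_neg_cancel, Pi.single_zero, add_zero, abs_neg] at h2
  rw [abs_le]
  constructor <;> linarith

lemma abs_map_sub_le [Fintype T] (h : HasQuadraticSlopes f M) (y z : T → ℝ) :
    |f z - f y| ≤ ∑ t, M t * |z t - y t| := by
  have key : ∀ s : Finset T,
      |f (y + ∑ t ∈ s, Pi.single t (z t - y t)) - f y| ≤ ∑ t ∈ s, M t * |z t - y t| := by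
    intro s
    induction s using Finset.induction_on with
    | empty => simp
    | insert a s ha ih =>
      rw [Finset.sum_insert ha, Finset.sum_insert ha, add_comm (Pi.single a _), ← add_assoc]
      have := h.abs_single_sub_le (y + ∑ t ∈ s, Pi.single t (z t - y t)) a (z a - y a)
      exact (abs_sub_le _ _ _).trans (add_le_add this ih)
  have := key Finset.univ
  rwa [Finset.univ_sum_single (fun t => z t - y t),
    show (y + fun t => z t - y t) = z from by ext; simp] at this

lemma continuous [Fintype T] (h : HasQuadraticSlopes f M) : Continuous f := by
  refine continuous_iff_continuousAt.2 fun y => ?_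
  rw [ContinuousAt, tendsto_iff_norm_sub_tendsto_zero]
  refine squeeze_zero (fun _ => norm_nonneg _) (fun z => h.abs_map_sub_le y z) ?_
  have : Continuous fun z : T → ℝ => ∑ t, M t * |z t - y t| := by fun_prop
  simpa using this.tendsto y

/-- The partial derivative of `f` in the direction `k`. -/
noncomputable def partialDeriv (f : (T → ℝ) → ℝ) (k : T) (y : T → ℝ) : ℝ :=
  deriv (fun x : ℝ => f (y + Pi.single k x)) 0

/-- The line and the parabola touch at `x = 0`, which forces differentiability there and identifies
the slope. A slope given by a derivative, rather than by a choice, is a measurable function of `y`,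
as taking its expectation requires. -/
lemma partialDeriv_spec (h : HasQuadraticSlopes f M) (y : T → ℝ) (k : T) :
    |partialDeriv f k y| ≤ M k ∧ ∀ x : ℝ,
      f y + x * partialDeriv f k y ≤ f (y + Pi.single k x) ∧
      f (y + Pi.single k x) ≤ f y + x * partialDeriv f k y + 4 * x ^ 2 * M k ^ 2 := by
  obtain ⟨g, hg, hgx⟩ := h y k
  suffices partialDeriv f k y = g by rw [this]; exact ⟨hg, hgx⟩
  refine HasDerivAt.deriv ?_
  rw [hasDerivAt_iff_isLittleO]
  refine Asymptotics.IsBigO.trans_isLittleO (g := fun x : ℝ => x ^ 2) ?_ ?_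
  · refine Asymptotics.IsBigO.of_bound (4 * M k ^ 2) (Filter.Eventually.of_forall fun x => ?_)
    have := hgx x
    rw [Pi.single_zero, add_zero, sub_zero, smul_eq_mul, Real.norm_eq_abs, Real.norm_eq_abs,
      abs_of_nonneg (sq_nonneg x), abs_of_nonneg (by linarith)]
    linarith
  · simpa using Asymptotics.isLittleO_pow_id (𝕜 := ℝ) (n := 2) one_lt_two

lemma measurable_partialDeriv [Fintype T] (h : HasQuadraticSlopes f M) (k : T) :
    Measurable (partialDeriv f k) := by
  have hc : Continuous (Function.uncurry fun (y : T → ℝ) (x : ℝ) => f (y + Pi.single k x)) := by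
    have h1 : Continuous fun p : (T → ℝ) × ℝ => p.1 + Pi.single k p.2 :=
      continuous_fst.add ((continuous_single (A := fun _ : T => ℝ) k).comp continuous_snd)
    exact h.continuous.comp h1
  exact (measurable_deriv_with_param hc).comp (measurable_id.prodMk measurable_const)

variable {Ω : Type*} {J : T → Ω → ℝ}

/-- The couplings `J t` for `t ∈ s`, the others being switched off. -/
noncomputable def mask (J : T → Ω → ℝ) (s : Finset T) (ω : Ω) : T → ℝ :=
  fun t => if t ∈ s then J t ω else 0

lemma mask_insert {s : Finset T} {k : T} (hk : k ∉ s) (ω : Ω) :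
    mask J (insert k s) ω = mask J s ω + Pi.single k (J k ω) := by
  ext t
  by_cases ht : t = k
  · subst ht; simp [mask, hk]
  · simp [mask, ht]

variable [Fintype T] [MeasurableSpace Ω] {Pr : Measure Ω} [IsProbabilityMeasure Pr]

lemma integrable_mask (h : HasQuadraticSlopes f M) (hJ : ∀ t, Measurable (J t)) {s : Finset T}
    (hi : ∀ t ∈ s, Integrable (fun ω => M t * |J t ω|) Pr) :
    Integrable (fun ω => f (mask J s ω)) Pr := by
  have hm : Measurable fun ω => mask J s ω :=
    measurable_pi_lambda _ fun t => by
      unfold mask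
      split_ifs
      exacts [hJ t, measurable_const]
  refine ((integrable_finsetSum s hi).add (integrable_const |f 0|)).mono'
    (h.continuous.measurable.comp hm).aestronglyMeasurable (Filter.Eventually.of_forall fun ω => ?_)
  have h1 := h.abs_map_sub_le 0 (mask J s ω)
  have h2 : ∑ t, M t * |mask J s ω t - (0 : T → ℝ) t| = ∑ t ∈ s, M t * |J t ω| := by
    rw [← Finset.sum_subset (Finset.subset_univ s)]
    · exact Finset.sum_congr rfl fun t ht => by simp [mask, ht]
    · intro t _ ht; simp [mask, ht]
  rw [h2] at h1
  have h3 := abs_sub_abs_le_abs_sub (f (mask J s ω)) (f 0)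
  simp only [Real.norm_eq_abs, Pi.add_apply]
  linarith

/-- Switching on an independent centred coupling increases the mean, but at most by a second
moment. -/
lemma integral_mask_insert (h : HasQuadraticSlopes f M) (hJ : ∀ t, Measurable (J t))
    (hind : iIndepFun J Pr) {s : Finset T} {k : T} (hk : k ∉ s)
    (hi : ∀ t ∈ s, Integrable (fun ω => M t * |J t ω|) Pr) (hk1 : Integrable (J k) Pr)
    (hk0 : ∫ ω, J k ω ∂Pr = 0) (hk2 : Integrable (fun ω => M k ^ 2 * J k ω ^ 2) Pr) :
    ∫ ω, f (mask J s ω) ∂Pr ≤ ∫ ω, f (mask J (insert k s) ω) ∂Pr ∧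
    ∫ ω, f (mask J (insert k s) ω) ∂Pr ≤
      ∫ ω, f (mask J s ω) ∂Pr + 4 * ∫ ω, M k ^ 2 * J k ω ^ 2 ∂Pr := by
  have hm : Measurable fun ω => mask J s ω :=
    measurable_pi_lambda _ fun t => by
      unfold mask
      split_ifs
      exacts [hJ t, measurable_const]
  set G : Ω → ℝ := fun ω => partialDeriv f k (mask J s ω) with hG
  have hGm : Measurable G := (h.measurable_partialDeriv k).comp hm
  -- The slope at `mask J s` depends only on the couplings in `s`, and `k ∉ s`.
  have hindep : IndepFun (J k) G Pr := by
    have h1 := hind.indepFun_finset {k} s (by simpa using hk) hJ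
    have h2 : Measurable fun (v : ({k} : Finset T) → ℝ) => v ⟨k, Finset.mem_singleton_self k⟩ :=
      measurable_pi_apply _
    have h3 : Measurable fun (v : s → ℝ) =>
        partialDeriv f k fun t => if ht : t ∈ s then v ⟨t, ht⟩ else 0 := by
      refine (h.measurable_partialDeriv k).comp (measurable_pi_lambda _ fun t => ?_)
      split_ifs
      exacts [measurable_pi_apply _, measurable_const]
    have h4 := h1.comp h2 h3
    have h5 : G = (fun (v : s → ℝ) =>
        partialDeriv f k fun t => if ht : t ∈ s then v ⟨t, ht⟩ else 0) ∘
        fun ω (i : s) => J i ω := by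
      ext ω
      simp only [hG, Function.comp_apply, dite_eq_ite]
      rfl
    rw [h5]
    exact h4
  have hprod : ∫ ω, J k ω * G ω ∂Pr = 0 := by
    have := hindep.integral_mul_eq_mul_integral (hJ k).aestronglyMeasurable
      hGm.aestronglyMeasurable
    simp only [Pi.mul_apply] at this
    rw [this, hk0, zero_mul]
  have hprodi : Integrable (fun ω => J k ω * G ω) Pr := by
    refine (hk1.norm.mul_const (M k)).mono' ((hJ k).mul hGm).aestronglyMeasurable
      (Filter.Eventually.of_forall fun ω => ?_)
    rw [norm_mul]
    exact mul_le_mul_of_nonneg_left (h.partialDeriv_spec (mask J s ω) k).1 (norm_nonneg _)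
  have hfi := h.integrable_mask hJ hi
  have hfi' : Integrable (fun ω => f (mask J (insert k s) ω)) Pr := by
    refine h.integrable_mask hJ fun t ht => ?_
    rcases Finset.mem_insert.1 ht with rfl | ht
    exacts [hk1.abs.const_mul _, hi t ht]
  have hsumi : Integrable (fun ω => f (mask J s ω) + J k ω * G ω) Pr := hfi.add hprodi
  -- The tangent line at `mask J s`, evaluated at the random step `J k`, has the same mean as `f`
  -- before the step.
  have hsum : ∫ ω, (f (mask J s ω) + J k ω * G ω) ∂Pr = ∫ ω, f (mask J s ω) ∂Pr := by
    rw [integral_add hfi hprodi, hprod, add_zero]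
  constructor
  · rw [← hsum]
    refine integral_mono hsumi hfi' fun ω => ?_
    rw [mask_insert hk]
    exact ((h.partialDeriv_spec (mask J s ω) k).2 (J k ω)).1
  · rw [← hsum, ← integral_const_mul, ← integral_add hsumi (hk2.const_mul 4)]
    refine integral_mono hfi' (hsumi.add (hk2.const_mul 4)) fun ω => ?_
    rw [mask_insert hk]
    have := ((h.partialDeriv_spec (mask J s ω) k).2 (J k ω)).2
    dsimp only
    linarith

/-- Bounds for the mean of `f` at random arguments: independent, and centred outside `s`. -/
theorem integral_bounds (h : HasQuadraticSlopes f M) (hJ : ∀ t, Measurable (J t))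
    (hind : iIndepFun J Pr) (s : Finset T)
    (hi : ∀ t ∈ s, Integrable (fun ω => M t * |J t ω|) Pr)
    (h1 : ∀ t ∉ s, Integrable (J t) Pr) (h0 : ∀ t ∉ s, ∫ ω, J t ω ∂Pr = 0)
    (h2 : ∀ t ∉ s, Integrable (fun ω => M t ^ 2 * J t ω ^ 2) Pr) :
    Integrable (fun ω => f fun t => J t ω) Pr ∧
    f 0 - ∑ t ∈ s, ∫ ω, M t * |J t ω| ∂Pr ≤ ∫ ω, f (fun t => J t ω) ∂Pr ∧
    ∫ ω, f (fun t => J t ω) ∂Pr ≤ f 0 + ∑ t ∈ s, ∫ ω, M t * |J t ω| ∂Pr +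
      4 * ∑ t ∈ sᶜ, ∫ ω, M t ^ 2 * J t ω ^ 2 ∂Pr := by
  have hall : ∀ t, Integrable (fun ω => M t * |J t ω|) Pr := fun t => by
    by_cases ht : t ∈ s
    exacts [hi t ht, (h1 t ht).abs.const_mul _]
  have huniv : ∀ ω, mask J Finset.univ ω = fun t => J t ω := fun ω => by ext; simp [mask]
  -- The couplings of `s` stay on while the centred ones are added one at a time.
  have hstep : ∀ r : Finset T, Disjoint r s →
      ∫ ω, f (mask J s ω) ∂Pr ≤ ∫ ω, f (mask J (r ∪ s) ω) ∂Pr ∧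
      ∫ ω, f (mask J (r ∪ s) ω) ∂Pr ≤ ∫ ω, f (mask J s ω) ∂Pr +
        4 * ∑ t ∈ r, ∫ ω, M t ^ 2 * J t ω ^ 2 ∂Pr := by
    intro r
    induction r using Finset.induction_on with
    | empty => simp
    | insert k r hk ih =>
      intro hd
      rw [Finset.disjoint_insert_left] at hd
      have hks : k ∉ r ∪ s := by simp [hk, hd.1]
      have hh := h.integral_mask_insert hJ hind hks (fun t _ => hall t) (h1 k hd.1) (h0 k hd.1)
        (h2 k hd.1)
      have ih' := ih hd.2
      rw [Finset.insert_union, Finset.sum_insert hk]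
      constructor <;> linarith [hh.1, hh.2, ih'.1, ih'.2]
  -- No centring is assumed on `s`, so the first-order term survives and the Lipschitz bound
  -- replaces the tangent argument.
  have hs : |∫ ω, f (mask J s ω) ∂Pr - f 0| ≤ ∑ t ∈ s, ∫ ω, M t * |J t ω| ∂Pr := by
    have hfi := h.integrable_mask hJ hi
    rw [← integral_finsetSum s hi]
    have : ∫ ω, f (mask J s ω) ∂Pr - f 0 = ∫ ω, (f (mask J s ω) - f 0) ∂Pr := by
      rw [integral_sub hfi (integrable_const _)]; simp
    rw [this]
    refine (abs_integral_le_integral_abs).trans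
      (integral_mono (hfi.sub (integrable_const _)).abs (integrable_finsetSum s hi) fun ω => ?_)
    refine (h.abs_map_sub_le 0 (mask J s ω)).trans (le_of_eq ?_)
    rw [← Finset.sum_subset (Finset.subset_univ s)]
    · exact Finset.sum_congr rfl fun t ht => by simp [mask, ht]
    · intro t _ ht; simp [mask, ht]
  have hfin := hstep sᶜ disjoint_compl_left
  rw [show sᶜ ∪ s = Finset.univ by rw [Finset.union_comm]; exact Finset.union_compl s] at hfin
  have hint := h.integrable_mask hJ (s := Finset.univ) (fun t _ => hall t)
  simp only [huniv] at hfin hint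
  have := abs_le.1 hs
  exact ⟨hint, by linarith [hfin.1, this.1], by linarith [hfin.2, this.2]⟩

end HasQuadraticSlopes

/-! ### Sums over the subsets of a volume -/

lemma translateSet_injective {d : ℕ} (a : Site d) :
    Function.Injective (translateSet a) :=
  fun _ _ h => Finset.map_injective _ h

/-- A translation invariant sum over the subsets of `Λ` is at most `|Λ|` times the weighted sum over
the sets that contain the origin. -/
lemma sum_powerset_le {d : ℕ} {W : Finset (Site d) → ℝ≥0∞} (h0 : W ∅ = 0)
    (hW : ∀ a X, W (translateSet a X) = W X) (Λ : Finset (Site d)) :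
    ∑ X ∈ Λ.powerset, W X ≤
      (Λ.card : ℝ≥0∞) *
        ∑' X : {X : Finset (Site d) // (0 : Site d) ∈ X}, W X / (X.1.card : ℝ≥0∞) := by
  -- Each `W X` is shared equally among the sites of `X`; the empty set has no site to carry a
  -- share, hence `h0`.
  have h1 : ∀ X ∈ Λ.powerset, W X = ∑ x ∈ Λ, if x ∈ X then W X / (X.card : ℝ≥0∞) else 0 := by
    intro X hX
    rw [← Finset.sum_filter, Finset.filter_mem_eq_inter,
      Finset.inter_eq_right.2 (Finset.mem_powerset.1 hX), Finset.sum_const, nsmul_eq_mul]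
    rcases X.eq_empty_or_nonempty with rfl | hne
    · simp [h0]
    · exact (ENNReal.mul_div_cancel (by simp [hne.ne_empty]) (by simp)).symm
  rw [Finset.sum_congr rfl h1, Finset.sum_comm, ← nsmul_eq_mul]
  refine Finset.sum_le_card_nsmul _ _ _ fun x _ => ?_
  rw [← Finset.sum_filter, ← Finset.sum_coe_sort, ← tsum_fintype (L := .unconditional _)]
  -- Translation by `-x` moves `x` to the origin, so the subsets of `Λ` through `x` inject into the
  -- sets containing `0`.
  let e : {X // X ∈ Λ.powerset.filter (x ∈ ·)} → {X : Finset (Site d) // (0 : Site d) ∈ X} :=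
    fun X => ⟨translateSet (-x) X.1, Finset.mem_map.2
      ⟨x, (Finset.mem_filter.1 X.2).2, neg_add_cancel x⟩⟩
  have he : Function.Injective e := fun X Y h =>
    Subtype.ext (translateSet_injective (-x) (congrArg Subtype.val h))
  refine le_trans (le_of_eq ?_) (ENNReal.tsum_comp_le_tsum_of_injective he
    fun X => W X.1 / (X.1.card : ℝ≥0∞))
  refine tsum_congr fun X => ?_
  simp only [e, translateSet, Finset.card_map]
  rw [← translateSet, hW]

/-! ### Moments of the couplings inside a volume -/

namespace Couplings

variable {d : ℕ} {ι : Type*} {Ω : Type*} [MeasurableSpace Ω] {Pr : Measure Ω}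

/-- The indices of the couplings inside `Λ`. -/
abbrev Terms (c : Couplings d ι Pr) (Λ : Finset (Site d)) : Type _ :=
  Σ X : {X // X ∈ Λ.powerset}, {j : ι // j ∈ c.n X.1}

lemma sum_terms {β : Type*} [AddCommMonoid β] (c : Couplings d ι Pr) (Λ : Finset (Site d))
    (F : (X : {X // X ∈ Λ.powerset}) → ι → β) :
    ∑ t : c.Terms Λ, F t.1 t.2.1 = ∑ X ∈ Λ.powerset.attach, ∑ j ∈ c.n X.1, F X j := by
  rw [Fintype.sum_sigma, ← Finset.univ_eq_attach]
  exact Finset.sum_congr rfl fun X _ => Finset.sum_coe_sort (c.n X.1) fun j => F X j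

/-- The weights of the interaction terms are translation invariant and finite, and vanish for the
empty set. -/
structure IsWeight (c : Couplings d ι Pr) (w : Finset (Site d) → ι → ℝ≥0∞) : Prop where
  empty : ∀ j ∈ c.n ∅, w ∅ j = 0
  translate : ∀ (a : Site d) (X : Finset (Site d)), ∀ j ∈ c.n X, w (translateSet a X) j = w X j
  ne_top : ∀ X, ∀ j ∈ c.n X, w X j ≠ ∞

variable {c : Couplings d ι Pr} {w : Finset (Site d) → ι → ℝ≥0∞}

lemma IsWeight.sum_terms_le (hw : c.IsWeight w) (p : ℕ) (hp : p ≠ 0) (Λ : Finset (Site d)) :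
    ∑ t : c.Terms Λ, (∫⁻ ω, ‖c.J t.1.1 t.2.1 ω‖ₑ ^ p ∂Pr) * w t.1.1 t.2.1 ^ p ≤
      (Λ.card : ℝ≥0∞) * ∑' X : {X : Finset (Site d) // (0 : Site d) ∈ X}, ∑ j ∈ c.n X.1,
        (∫⁻ ω, ‖c.J X.1 j ω‖ₑ ^ p ∂Pr) * w X.1 j ^ p / (X.1.card : ℝ≥0∞) := by
  rw [c.sum_terms Λ fun X j => (∫⁻ ω, ‖c.J X.1 j ω‖ₑ ^ p ∂Pr) * w X.1 j ^ p,
    Finset.sum_attach Λ.powerset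
      fun X => ∑ j ∈ c.n X, (∫⁻ ω, ‖c.J X j ω‖ₑ ^ p ∂Pr) * w X j ^ p]
  refine (sum_powerset_le (W := fun X => ∑ j ∈ c.n X, (∫⁻ ω, ‖c.J X j ω‖ₑ ^ p ∂Pr) * w X j ^ p)
    ?_ ?_ Λ).trans (le_of_eq ?_)
  · exact Finset.sum_eq_zero fun j hj => by rw [hw.empty j hj, zero_pow hp, mul_zero]
  · intro a X
    simp only [c.n_translate a X]
    refine Finset.sum_congr rfl fun j hj => ?_
    have hm : Measurable fun x : ℝ => ‖x‖ₑ ^ p := by fun_prop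
    rw [hw.translate a X j hj]
    congr 1
    exact ((c.identDistrib_J a X j hj).comp hm).lintegral_eq
  · congr 1
    refine tsum_congr fun X => ?_
    simp only [div_eq_mul_inv, Finset.sum_mul]

/-- In extended nonnegative reals the moment sum always makes sense; its finiteness yields
integrability of every term, after which the bound passes to real integrals. -/
lemma IsWeight.integral_terms (hw : c.IsWeight w) (p : ℕ) (Λ : Finset (Site d))
    {S : ℝ≥0∞} (hS : S ≠ ∞)
    (hle : ∑ t : c.Terms Λ, (∫⁻ ω, ‖c.J t.1.1 t.2.1 ω‖ₑ ^ p ∂Pr) * w t.1.1 t.2.1 ^ p ≤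
      (Λ.card : ℝ≥0∞) * S) :
    (∀ t : c.Terms Λ,
      Integrable (fun ω => (w t.1.1 t.2.1).toReal ^ p * |c.J t.1.1 t.2.1 ω| ^ p) Pr) ∧
    ∑ t : c.Terms Λ, ∫ ω, (w t.1.1 t.2.1).toReal ^ p * |c.J t.1.1 t.2.1 ω| ^ p ∂Pr ≤
      (Λ.card : ℝ) * S.toReal := by
  have hNS : (Λ.card : ℝ≥0∞) * S ≠ ∞ := ENNReal.mul_ne_top (by simp) hS
  have henorm : ∀ t : c.Terms Λ,
      ∫⁻ ω, ‖(w t.1.1 t.2.1).toReal ^ p * |c.J t.1.1 t.2.1 ω| ^ p‖ₑ ∂Pr =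
        (∫⁻ ω, ‖c.J t.1.1 t.2.1 ω‖ₑ ^ p ∂Pr) * w t.1.1 t.2.1 ^ p := by
    intro t
    have hJ := c.measurable_J t.1.1 t.2.1 t.2.2
    rw [mul_comm, ← lintegral_const_mul _ (by fun_prop)]
    refine lintegral_congr fun ω => ?_
    rw [enorm_mul, enorm_pow, enorm_pow, Real.enorm_abs,
      Real.enorm_eq_ofReal ENNReal.toReal_nonneg, ENNReal.ofReal_toReal (hw.ne_top _ _ t.2.2)]
  have hfin : ∀ t : c.Terms Λ,
      (∫⁻ ω, ‖c.J t.1.1 t.2.1 ω‖ₑ ^ p ∂Pr) * w t.1.1 t.2.1 ^ p ≠ ∞ := fun t =>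
    ne_top_of_le_ne_top hNS ((Finset.single_le_sum
      (f := fun t : c.Terms Λ => (∫⁻ ω, ‖c.J t.1.1 t.2.1 ω‖ₑ ^ p ∂Pr) * w t.1.1 t.2.1 ^ p)
      (fun _ _ => zero_le) (Finset.mem_univ t)).trans hle)
  have hm : ∀ t : c.Terms Λ, AEStronglyMeasurable
      (fun ω => (w t.1.1 t.2.1).toReal ^ p * |c.J t.1.1 t.2.1 ω| ^ p) Pr := fun t => by
    have hJ := c.measurable_J t.1.1 t.2.1 t.2.2
    exact Measurable.aestronglyMeasurable (by fun_prop)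
  refine ⟨fun t => ⟨hm t, ?_⟩, ?_⟩
  · rw [HasFiniteIntegral, henorm t]
    exact (hfin t).lt_top
  · have hint : ∀ t : c.Terms Λ,
        ∫ ω, (w t.1.1 t.2.1).toReal ^ p * |c.J t.1.1 t.2.1 ω| ^ p ∂Pr =
          ((∫⁻ ω, ‖c.J t.1.1 t.2.1 ω‖ₑ ^ p ∂Pr) * w t.1.1 t.2.1 ^ p).toReal := fun t => by
      rw [← henorm t, ← integral_norm_eq_lintegral_enorm (hm t)]
      refine integral_congr_ae (Filter.Eventually.of_forall fun ω => ?_)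
      exact (Real.norm_of_nonneg (by positivity)).symm
    rw [Finset.sum_congr rfl fun t _ => hint t, ← ENNReal.toReal_sum fun t _ => hfin t]
    refine (ENNReal.toReal_mono hNS hle).trans (le_of_eq ?_)
    simp

end Couplings

/-- Bounds for the mean of a function of the couplings inside `Λ`, whose slopes are controlled by
the weights. -/
theorem Couplings.integral_bounds {d : ℕ} {ι₁ ι₂ : Type*} {Ω : Type*} [MeasurableSpace Ω]
    {Pr : Measure Ω} [IsProbabilityMeasure Pr] {c₁ : Couplings d ι₁ Pr} {c₂ : Couplings d ι₂ Pr}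
    {w₁ : Finset (Site d) → ι₁ → ℝ≥0∞} {w₂ : Finset (Site d) → ι₂ → ℝ≥0∞}
    (hw₁ : c₁.IsWeight w₁) (hw₂ : c₂.IsWeight w₂) (hind : c₁.JointlyIndep c₂) (h0 : c₂.ZeroMean)
    (hn₁ : c₁.weightedNorm1 w₁ < ∞) (hn₂ : c₂.weightedNorm2 w₂ < ∞) (Λ : Finset (Site d))
    [DecidableEq (c₁.Terms Λ ⊕ c₂.Terms Λ)] {f : (c₁.Terms Λ ⊕ c₂.Terms Λ → ℝ) → ℝ}
    (hf : HasQuadraticSlopes f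
      (Sum.elim (fun t => (w₁ t.1.1 t.2.1).toReal) fun t => (w₂ t.1.1 t.2.1).toReal))
    {F : Ω → ℝ}
    (hF : ∀ᵐ ω ∂Pr, F ω =
      f (Sum.elim (fun t => c₁.J t.1.1 t.2.1 ω) fun t => c₂.J t.1.1 t.2.1 ω)) :
    Integrable F Pr ∧
    f 0 - Λ.card * (c₁.weightedNorm1 w₁).toReal ≤ ∫ ω, F ω ∂Pr ∧
    ∫ ω, F ω ∂Pr ≤ f 0 + Λ.card * (c₁.weightedNorm1 w₁).toReal +
      4 * (Λ.card * (c₂.weightedNorm2 w₂).toReal ^ 2) := by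
  set J : c₁.Terms Λ ⊕ c₂.Terms Λ → Ω → ℝ :=
    Sum.elim (fun t => c₁.J t.1.1 t.2.1) fun t => c₂.J t.1.1 t.2.1 with hJ
  have hJm : ∀ t, Measurable (J t) := by
    rintro (t | t)
    exacts [c₁.measurable_J _ _ t.2.2, c₂.measurable_J _ _ t.2.2]
  have hJind : iIndepFun J Pr := by
    let e₁ : c₁.Terms Λ → c₁.Index := fun t => ⟨t.1.1, t.2⟩
    let e₂ : c₂.Terms Λ → c₂.Index := fun t => ⟨t.1.1, t.2⟩
    have he₁ : Function.Injective e₁ := by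
      rintro ⟨⟨X, hX⟩, j⟩ ⟨⟨Y, hY⟩, k⟩ h
      obtain ⟨rfl, h⟩ := Sigma.mk.inj_iff.1 h
      cases h
      rfl
    have he₂ : Function.Injective e₂ := by
      rintro ⟨⟨X, hX⟩, j⟩ ⟨⟨Y, hY⟩, k⟩ h
      obtain ⟨rfl, h⟩ := Sigma.mk.inj_iff.1 h
      cases h
      rfl
    have := iIndepFun.precomp (he₁.sumMap he₂) hind
    convert this using 1
    ext t
    rcases t with t | t <;> rfl
  have h1 := hw₁.sum_terms_le 1 one_ne_zero Λ
  simp only [pow_one] at h1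
  change _ ≤ _ * c₁.weightedNorm1 w₁ at h1
  have i1 := hw₁.integral_terms 1 Λ hn₁.ne (by simpa only [pow_one] using h1)
  simp only [pow_one] at i1
  have hn₂' := hn₂.ne
  rw [weightedNorm2, Ne, ENNReal.rpow_eq_top_iff_of_pos (by norm_num)] at hn₂'
  have i2 := hw₂.integral_terms 2 Λ hn₂' (hw₂.sum_terms_le 2 two_ne_zero Λ)
  simp only [sq_abs] at i2
  have hsq : (c₂.weightedNorm2 w₂).toReal ^ 2 = (∑' X : {X : Finset (Site d) // (0 : Site d) ∈ X},
      ∑ j ∈ c₂.n X.1,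
        (∫⁻ ω, ‖c₂.J X.1 j ω‖ₑ ^ 2 ∂Pr) * w₂ X.1 j ^ 2 / (X.1.card : ℝ≥0∞)).toReal := by
    rw [weightedNorm2, ← ENNReal.toReal_rpow, ← Real.rpow_natCast,
      ← Real.rpow_mul ENNReal.toReal_nonneg]
    norm_num
  rw [← hsq] at i2
  -- The distinguished set `s` consists of the couplings of `c₁`; its complement, the couplings of
  -- `c₂`, is centred.
  have key := hf.integral_bounds hJm hJind (Finset.univ.map Function.Embedding.inl)
    (by
      intro t ht
      obtain ⟨t, -, rfl⟩ := Finset.mem_map.1 ht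
      exact i1.1 t)
    (by
      rintro (t | t) ht
      · exact absurd (Finset.mem_map_of_mem _ (Finset.mem_univ t)) ht
      · exact (h0 _ _ t.2.2).1)
    (by
      rintro (t | t) ht
      · exact absurd (Finset.mem_map_of_mem _ (Finset.mem_univ t)) ht
      · exact (h0 _ _ t.2.2).2)
    (by
      rintro (t | t) ht
      · exact absurd (Finset.mem_map_of_mem _ (Finset.mem_univ t)) ht
      · exact i2.1 t)
  have hcompl : (Finset.univ.map Function.Embedding.inl : Finset (c₁.Terms Λ ⊕ c₂.Terms Λ))ᶜ =
      Finset.univ.map Function.Embedding.inr := by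
    ext t
    rcases t with t | t <;> simp
  rw [hcompl, Finset.sum_map, Finset.sum_map] at key
  have hF' : ∀ᵐ ω ∂Pr, F ω = f fun t => J t ω := by
    filter_upwards [hF] with ω h
    rw [h]
    congr 1
    ext t
    rcases t with t | t <;> rfl
  rw [integrable_congr hF', integral_congr_ae hF']
  simp only [hJ, Function.Embedding.inl_apply, Function.Embedding.inr_apply, Sum.elim_inl,
    Sum.elim_inr] at key ⊢
  exact ⟨key.1, by linarith [key.2.1, i1.2], by linarith [key.2.2, i1.2, i2.2]⟩

/-! ### Classical free energies -/

/-- The logarithmic partition function is controlled in the direction `φ` by its slope, the Gibbs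
expectation of `φ`. -/
lemma exists_slope_log_integral_exp {α : Type*} [MeasurableSpace α] {ν : Measure α}
    [IsProbabilityMeasure ν] {A φ : α → ℝ} {C M : ℝ} (hA : AEMeasurable A ν)
    (hAC : ∀ σ, |A σ| ≤ C) (hφ : AEMeasurable φ ν) (hφM : ∀ σ, |φ σ| ≤ M) :
    ∃ g : ℝ, |g| ≤ M ∧ ∀ x : ℝ,
      Real.log (∫ σ, Real.exp (A σ) ∂ν) + x * g ≤
        Real.log (∫ σ, Real.exp (A σ + x * φ σ) ∂ν) ∧
      Real.log (∫ σ, Real.exp (A σ + x * φ σ) ∂ν) ≤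
        Real.log (∫ σ, Real.exp (A σ) ∂ν) + x * g + 4 * x ^ 2 * M ^ 2 := by
  have hM : 0 ≤ M := by
    obtain ⟨σ⟩ := nonempty_of_isProbabilityMeasure ν
    exact (abs_nonneg _).trans (hφM σ)
  have hexpA : Integrable (fun σ => Real.exp (A σ)) ν := by
    refine Integrable.of_bound (Real.measurable_exp.comp_aemeasurable hA).aestronglyMeasurable
      (Real.exp C) (Filter.Eventually.of_forall fun σ => ?_)
    rw [Real.norm_of_nonneg (Real.exp_pos _).le]
    exact Real.exp_le_exp.2 ((le_abs_self _).trans (hAC σ))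
  -- `ρ` is the Gibbs measure of `A`. The quotient of the two partition functions is the Laplace
  -- transform of `φ` under `ρ`, and the slope is the `ρ`-mean of `φ`.
  set ρ := ν.tilted A with hρ
  have : IsProbabilityMeasure ρ := isProbabilityMeasure_tilted hexpA
  have hφρ : AEMeasurable φ ρ := hφ.mono_ac (tilted_absolutelyContinuous ν A)
  have hφi : Integrable φ ρ := Integrable.of_bound hφρ.aestronglyMeasurable M
    (Filter.Eventually.of_forall fun σ => by simpa using hφM σ)
  have hexp : ∀ x : ℝ, Integrable (fun σ => Real.exp (x * φ σ)) ρ := fun x => by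
    refine Integrable.of_bound
      (Real.measurable_exp.comp_aemeasurable (hφρ.const_mul x)).aestronglyMeasurable
      (Real.exp (|x| * M)) (Filter.Eventually.of_forall fun σ => ?_)
    rw [Real.norm_of_nonneg (Real.exp_pos _).le]
    refine Real.exp_le_exp.2 ((le_abs_self _).trans ?_)
    rw [abs_mul]
    exact mul_le_mul_of_nonneg_left (hφM σ) (abs_nonneg x)
  have hlog : ∀ x : ℝ, Real.log (∫ σ, Real.exp (A σ + x * φ σ) ∂ν) =
      Real.log (∫ σ, Real.exp (A σ) ∂ν) + Real.log (∫ σ, Real.exp (x * φ σ) ∂ρ) := fun x => by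
    have h1 := integral_exp_tilted (μ := ν) A fun σ => x * φ σ
    have hZ : (∫ σ, Real.exp (A σ) ∂ν) ≠ 0 := (integral_exp_pos hexpA).ne'
    rw [eq_div_iff hZ] at h1
    simp only [Pi.add_apply] at h1
    rw [← h1, Real.log_mul (integral_exp_pos (hexp x)).ne' hZ, add_comm]
  refine ⟨∫ σ, φ σ ∂ρ, ?_, fun x => ?_⟩
  · have := norm_integral_le_of_norm_le_const (μ := ρ) (f := φ) (C := M)
      (Filter.Eventually.of_forall fun σ => by simpa using hφM σ)
    simpa using this
  · rw [hlog x]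
    set g := ∫ σ, φ σ ∂ρ with hg
    have hsplit : ∫ σ, Real.exp (x * φ σ) ∂ρ =
        Real.exp (x * g) * ∫ σ, Real.exp (x * (φ σ - g)) ∂ρ := by
      rw [← integral_const_mul]
      refine integral_congr_ae (Filter.Eventually.of_forall fun σ => ?_)
      dsimp only
      rw [← Real.exp_add]
      congr 1
      ring
    have hcent : Integrable (fun σ => Real.exp (x * (φ σ - g))) ρ := by
      refine ((hexp x).mul_const (Real.exp (-(x * g)))).congr
        (Filter.Eventually.of_forall fun σ => ?_)
      dsimp only
      rw [← Real.exp_add]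
      congr 1
      ring
    have hpos := integral_exp_pos hcent
    rw [hsplit, Real.log_mul (Real.exp_pos _).ne' hpos.ne', Real.log_exp]
    constructor
    -- Jensen's inequality, through `1 + t ≤ exp t` for the centred variable.
    · have h1 : (1 : ℝ) ≤ ∫ σ, Real.exp (x * (φ σ - g)) ∂ρ := by
        have hi : Integrable (fun σ => x * (φ σ - g)) ρ :=
          (hφi.sub (integrable_const g)).const_mul x
        have h2 : ∫ σ, (x * (φ σ - g) + 1) ∂ρ = 1 := by
          rw [integral_add hi (integrable_const _), integral_const_mul,
            integral_sub hφi (integrable_const g)]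
          simp [hg]
        rw [← h2]
        exact integral_mono (hi.add (integrable_const _)) hcent fun σ => Real.add_one_le_exp _
      linarith [Real.log_nonneg h1]
    -- Hoeffding's lemma on `[-M, M]` has variance proxy `M²`, so the excess is at most `x² M² / 2`.
    · have hsub := (hasSubgaussianMGF_of_mem_Icc hφρ
        (Filter.Eventually.of_forall fun σ => abs_le.1 (hφM σ))).mgf_le x
      simp only [mgf] at hsub
      have h1 := Real.log_le_log hpos hsub
      rw [Real.log_exp] at h1
      have h2 : (((‖M - -M‖₊ / 2) ^ 2 : NNReal) : ℝ) = M ^ 2 := by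
        push_cast
        rw [sub_neg_eq_add, Real.norm_of_nonneg (by linarith)]
        ring
      rw [h2] at h1
      nlinarith [mul_nonneg (sq_nonneg x) (sq_nonneg M)]

lemma hasQuadraticSlopes_log_integral_exp {α : Type*} [MeasurableSpace α] {ν : Measure α}
    [IsProbabilityMeasure ν] {T : Type*} [Fintype T] [DecidableEq T] {φ : T → α → ℝ} {M : T → ℝ}
    (hφ : ∀ t, AEMeasurable (φ t) ν) (hφM : ∀ t σ, |φ t σ| ≤ M t) :
    HasQuadraticSlopes (fun y => Real.log (∫ σ, Real.exp (∑ t, y t * φ t σ) ∂ν)) M := by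
  intro y k
  obtain ⟨g, hg, hgx⟩ := exists_slope_log_integral_exp (ν := ν) (A := fun σ => ∑ t, y t * φ t σ)
    (C := ∑ t, |y t| * M t) (φ := φ k) (Finset.aemeasurable_fun_sum _ fun t _ => (hφ t).const_mul _)
    (fun σ => (Finset.abs_sum_le_sum_abs _ _).trans (Finset.sum_le_sum fun t _ => by
      rw [abs_mul]
      exact mul_le_mul_of_nonneg_left (hφM t σ) (abs_nonneg _))) (hφ k) (hφM k)
  have hadd : ∀ (x : ℝ) σ, ∑ t, (y + Pi.single k x : T → ℝ) t * φ t σ =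
      ∑ t, y t * φ t σ + x * φ k σ := by
    intro x σ
    simp only [Pi.add_apply, add_mul, Finset.sum_add_distrib]
    congr 1
    rw [Finset.sum_eq_single k (fun t _ ht => by simp [ht]) (by simp)]
    simp
  refine ⟨g, hg, fun x => ?_⟩
  simp only [hadd]
  exact hgx x

/-- The interactions are only almost everywhere measurable, so composing them with a restriction
requires null sets to pull back to null sets. -/
lemma measurePreserving_restrict₂_pi {d : ℕ} {S : Type*} [MeasurableSpace S] (μ : Measure S)
    [IsProbabilityMeasure μ] {X Λ : Finset (Site d)} (h : X ⊆ Λ) :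
    MeasurePreserving (Finset.restrict₂ (π := fun _ => S) h) (Measure.pi fun _ : Λ => μ)
      (Measure.pi fun _ : X => μ) :=
  ⟨Finset.measurable_restrict₂ h,
    (isProjectiveMeasureFamily_pi (fun _ : Site d => μ) Λ X h).symm⟩

/-- Translation of configurations, as an equivalence. -/
def pullbackEquiv {d : ℕ} {α : Type*} (a : Site d) (X : Finset (Site d)) :
    (translateSet a X → α) ≃ (X → α) where
  toFun := pullback a X
  invFun s i := s ⟨i.1 - a, by
    obtain ⟨x, hx, hi⟩ := Finset.mem_map.1 i.2
    rw [← hi]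
    simpa using hx⟩
  left_inv s := by
    ext i
    simp [pullback]
  right_inv s := by
    ext i
    simp [pullback]

namespace ClassicalPotential

variable {d : ℕ} {S : Type*} [MeasurableSpace S] {μ : Measure S} {ι : Type*} {Ω : Type*}
  [MeasurableSpace Ω] {Pr : Measure Ω}

lemma isWeight_normΦ (U : ClassicalPotential d μ ι Pr) : U.IsWeight U.normΦ where
  empty j hj := by simp [normΦ, U.Φ_empty j hj]
  translate a X j hj := by
    simp only [normΦ, U.Φ_translate a X j hj]
    exact (pullbackEquiv a X).surjective.iSup_comp fun σ => ‖U.Φ X j σ‖ₑ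
  ne_top X j hj := by
    obtain ⟨C, hC⟩ := U.bounded_Φ X j hj
    refine ne_top_of_le_ne_top (ENNReal.ofReal_ne_top (r := C)) (iSup_le fun σ => ?_)
    rw [Real.enorm_eq_ofReal_abs]
    exact ENNReal.ofReal_le_ofReal (hC σ)

lemma abs_Φ_le (U : ClassicalPotential d μ ι Pr) {X : Finset (Site d)} {j : ι} (hj : j ∈ U.n X)
    (σ : X → S) : |U.Φ X j σ| ≤ (U.normΦ X j).toReal := by
  have h := ENNReal.toReal_mono (U.isWeight_normΦ.ne_top X j hj)
    (le_iSup (fun σ => ‖U.Φ X j σ‖ₑ) σ)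
  rwa [toReal_enorm] at h

/-- The interaction terms inside `Λ`, as functions on `S^Λ`. -/
noncomputable def term (U : ClassicalPotential d μ ι Pr) {Λ : Finset (Site d)}
    (t : U.Terms Λ) (σ : Λ → S) : ℝ :=
  U.Φ t.1.1 t.2.1 (Finset.restrict₂ (π := fun _ => S) (Finset.mem_powerset.1 t.1.2) σ)

lemma potential_eq_sum_term (U : ClassicalPotential d μ ι Pr) (Λ : Finset (Site d)) (ω : Ω)
    (σ : Λ → S) : U.potential Λ ω σ = ∑ t : U.Terms Λ, U.J t.1.1 t.2.1 ω * U.term t σ :=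
  (U.sum_terms Λ fun X j => U.J X.1 j ω *
    U.Φ X.1 j (Finset.restrict₂ (π := fun _ => S) (Finset.mem_powerset.1 X.2) σ)).symm

theorem IsStableDecomposition.integral_bounds [IsProbabilityMeasure Pr] [IsProbabilityMeasure μ]
    {ι₁ ι₂ : Type*} {U : ClassicalPotential d μ ι Pr} {Ut : ClassicalPotential d μ ι₁ Pr}
    {Uh : ClassicalPotential d μ ι₂ Pr} (h : U.IsStableDecomposition Ut Uh)
    (Λ : Finset (Site d)) :
    Integrable (fun ω => Real.log (U.partitionFunction Λ ω)) Pr ∧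
    -(Λ.card * Ut.norm1.toReal) ≤ U.pressure Λ ∧
    U.pressure Λ ≤ Λ.card * Ut.norm1.toReal + 4 * (Λ.card * Uh.norm2.toReal ^ 2) := by
  classical
  have hf := hasQuadraticSlopes_log_integral_exp (ν := Measure.pi fun _ : Λ => μ)
    (φ := Sum.elim (Ut.term (Λ := Λ)) (Uh.term (Λ := Λ)))
    (M := Sum.elim (fun t => (Ut.normΦ t.1.1 t.2.1).toReal)
      fun t => (Uh.normΦ t.1.1 t.2.1).toReal)
    (by
      rintro (t | t)
      · exact (Ut.aemeasurable_Φ _ _ t.2.2).comp_quasiMeasurePreserving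
          (measurePreserving_restrict₂_pi μ (Finset.mem_powerset.1 t.1.2)).quasiMeasurePreserving
      · exact (Uh.aemeasurable_Φ _ _ t.2.2).comp_quasiMeasurePreserving
          (measurePreserving_restrict₂_pi μ (Finset.mem_powerset.1 t.1.2)).quasiMeasurePreserving)
    (by
      rintro (t | t) σ
      exacts [Ut.abs_Φ_le t.2.2 _, Uh.abs_Φ_le t.2.2 _])
  have key := Couplings.integral_bounds Ut.isWeight_normΦ Uh.isWeight_normΦ h.indep h.zeroMean
    h.norm1_lt_top h.norm2_lt_top Λ hf
    (F := fun ω => Real.log (U.partitionFunction Λ ω))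
    (by
      filter_upwards [h.eq_add Λ] with ω hω
      simp only [partitionFunction, hω, potential_eq_sum_term, Fintype.sum_sum_type, Sum.elim_inl,
        Sum.elim_inr])
  -- With all couplings zero the partition function is the total mass 1, so `f 0 = 0`.
  simpa [pressure, norm1, norm2] using key

end ClassicalPotential

/-! ### Quantum free energies -/

lemma exp_mul_sub_le (u v : ℝ) : Real.exp (2 * v) * (2 * (u - v)) ≤
    Real.exp (2 * u) - Real.exp (2 * v) := by
  have h1 := Real.add_one_le_exp (2 * (u - v))
  have h2 : Real.exp (2 * u) = Real.exp (2 * v) * Real.exp (2 * (u - v)) := by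
    rw [← Real.exp_add]; ring_nf
  rw [h2]
  nlinarith [Real.exp_pos (2 * v)]

/-- Using `1 + t ≤ exp t` at the half exponent `t = v - u` leaves a square to spare. Summed over
probabilities `exp (2 * u)` and `exp (2 * v)`, this says that relative entropy dominates the squared
Hellinger distance. -/
lemma exp_mul_sub_le_sub_sq (u v : ℝ) : Real.exp (2 * u) * (2 * (v - u)) ≤
    Real.exp (2 * v) - Real.exp (2 * u) - (Real.exp u - Real.exp v) ^ 2 := by
  have h1 := Real.add_one_le_exp (v - u)
  have h2 : Real.exp v = Real.exp u * Real.exp (v - u) := by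
    rw [← Real.exp_add]; ring_nf
  have h3 : ∀ x : ℝ, Real.exp (2 * x) = Real.exp x ^ 2 := fun x => by
    rw [← Real.exp_nat_mul]; norm_num
  rw [h3, h3, h2]
  nlinarith [mul_le_mul_of_nonneg_left h1 (sq_nonneg (Real.exp u))]

/-- Comparison of the free energies of two spectra `a`, `b` that are coupled by a doubly stochastic
matrix `w`: the free energy of `b` lies above the first order expansion around `a`, by at most the
variance bound `K`. -/
lemma log_sum_exp_bounds {m n : Type*} [Fintype m] [Fintype n] [Nonempty m] [Nonempty n]
    {w : m → n → ℝ} (hw : ∀ i j, 0 ≤ w i j) (hrow : ∀ i, ∑ j, w i j = 1)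
    (hcol : ∀ j, ∑ i, w i j = 1) {a : n → ℝ} {b : m → ℝ} {K : ℝ}
    (hrow2 : ∀ i, ∑ j, w i j * (b i - a j) ^ 2 ≤ K)
    (hcol2 : ∀ j, ∑ i, w i j * (b i - a j) ^ 2 ≤ K) :
    let G := ∑ j, Real.exp (a j - Real.log (∑ j, Real.exp (a j))) * ∑ i, w i j * (b i - a j)
    Real.log (∑ j, Real.exp (a j)) + G ≤ Real.log (∑ i, Real.exp (b i)) ∧
    Real.log (∑ i, Real.exp (b i)) ≤ Real.log (∑ j, Real.exp (a j)) + G + K := by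
  intro G
  set L₀ := Real.log (∑ j, Real.exp (a j)) with hL₀
  set L₁ := Real.log (∑ i, Real.exp (b i)) with hL₁
  have hq : ∑ j, Real.exp (a j - L₀) = 1 := by
    have hpos : 0 < ∑ j, Real.exp (a j) :=
      Finset.sum_pos (fun j _ => Real.exp_pos _) Finset.univ_nonempty
    simp_rw [Real.exp_sub, ← Finset.sum_div]
    rw [hL₀, Real.exp_log hpos, div_self hpos.ne']
  have hp : ∑ i, Real.exp (b i - L₁) = 1 := by
    have hpos : 0 < ∑ i, Real.exp (b i) :=
      Finset.sum_pos (fun j _ => Real.exp_pos _) Finset.univ_nonempty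
    simp_rw [Real.exp_sub, ← Finset.sum_div]
    rw [hL₁, Real.exp_log hpos, div_self hpos.ne']
  have hwp : ∑ j, ∑ i, w i j * Real.exp (b i - L₁) = 1 := by
    rw [Finset.sum_comm]
    simp_rw [← Finset.sum_mul, hrow, one_mul]
    exact hp
  have hwq : ∑ j, ∑ i, w i j * Real.exp (a j - L₀) = 1 := by
    simp_rw [← Finset.sum_mul, hcol, one_mul]
    exact hq
  have hG : G = ∑ j, ∑ i, w i j * (Real.exp (a j - L₀) * (b i - a j)) := by
    simp only [G, Finset.mul_sum]
    exact Finset.sum_congr rfl fun j _ => Finset.sum_congr rfl fun i _ => by ring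
  have hp2 : ∑ j, ∑ i, w i j * (Real.exp (b i - L₁) * (b i - a j) ^ 2) ≤ K := by
    rw [Finset.sum_comm]
    calc _ = ∑ i, Real.exp (b i - L₁) * ∑ j, w i j * (b i - a j) ^ 2 := by
          simp_rw [Finset.mul_sum]
          exact Finset.sum_congr rfl fun j _ => Finset.sum_congr rfl fun i _ => by ring
      _ ≤ ∑ i, Real.exp (b i - L₁) * K := Finset.sum_le_sum fun i _ =>
          mul_le_mul_of_nonneg_left (hrow2 i) (Real.exp_pos _).le
      _ = K := by rw [← Finset.sum_mul, hp, one_mul]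
  have hq2 : ∑ j, ∑ i, w i j * (Real.exp (a j - L₀) * (b i - a j) ^ 2) ≤ K := by
    calc _ = ∑ j, Real.exp (a j - L₀) * ∑ i, w i j * (b i - a j) ^ 2 := by
          simp_rw [Finset.mul_sum]
          exact Finset.sum_congr rfl fun j _ => Finset.sum_congr rfl fun i _ => by ring
      _ ≤ ∑ j, Real.exp (a j - L₀) * K := Finset.sum_le_sum fun j _ =>
          mul_le_mul_of_nonneg_left (hcol2 j) (Real.exp_pos _).le
      _ = K := by rw [← Finset.sum_mul, hq, one_mul]
  have e1 : ∀ i, Real.exp (b i - L₁) = Real.exp (2 * ((b i - L₁) / 2)) := fun i => by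
    congr 1; ring
  have e2 : ∀ j, Real.exp (a j - L₀) = Real.exp (2 * ((a j - L₀) / 2)) := fun j => by
    congr 1; ring
  constructor
  -- The Peierls–Bogoliubov inequality: the gradient inequality for `exp`, averaged with `w`. Both
  -- families of Gibbs weights have total mass one, so the right side sums to zero.
  · have h : ∑ j, ∑ i, (w i j * (Real.exp (a j - L₀) * (b i - a j)) -
        (L₁ - L₀) * (w i j * Real.exp (a j - L₀))) ≤
        ∑ j, ∑ i, (w i j * Real.exp (b i - L₁) - w i j * Real.exp (a j - L₀)) := by
      refine Finset.sum_le_sum fun j _ => Finset.sum_le_sum fun i _ => ?_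
      have := mul_le_mul_of_nonneg_left (exp_mul_sub_le ((b i - L₁) / 2) ((a j - L₀) / 2)) (hw i j)
      rw [← e1, ← e2] at this
      linarith
    simp only [Finset.sum_sub_distrib, ← Finset.mul_sum] at h
    rw [hwp, hwq, ← hG] at h
    linarith
  · have h : ∑ j, ∑ i, ((L₁ - L₀) * (w i j * Real.exp (b i - L₁)) -
        w i j * (Real.exp (a j - L₀) * (b i - a j))) ≤
        ∑ j, ∑ i, (w i j * Real.exp (a j - L₀) - w i j * Real.exp (b i - L₁) +
          (w i j * (Real.exp (b i - L₁) * (b i - a j) ^ 2) / 2 +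
            w i j * (Real.exp (a j - L₀) * (b i - a j) ^ 2) / 2)) := by
      refine Finset.sum_le_sum fun j _ => Finset.sum_le_sum fun i _ => ?_
      -- With `s`, `r` the square roots of the two Gibbs weights, the error `(s² - r²)(b - a)` is at
      -- most `(s - r)² + (s + r)²(b - a)²/4`. The Hellinger term absorbs `(s - r)²`, and `(s + r)²
      -- ≤ 2(s² + r²)` gives the rest.
      have key : Real.exp (b i - L₁) * (L₁ - L₀) - Real.exp (a j - L₀) * (b i - a j) ≤
          Real.exp (a j - L₀) - Real.exp (b i - L₁) +
          (Real.exp (b i - L₁) + Real.exp (a j - L₀)) * (b i - a j) ^ 2 / 2 := by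
        have h1 := exp_mul_sub_le_sub_sq ((b i - L₁) / 2) ((a j - L₀) / 2)
        rw [← e1, ← e2] at h1
        have h3 : ∀ x : ℝ, Real.exp x = Real.exp (x / 2) ^ 2 := fun x => by
          rw [← Real.exp_nat_mul]; congr 1; push_cast; ring
        have h4 := h3 (b i - L₁)
        have h5 := h3 (a j - L₀)
        generalize Real.exp ((b i - L₁) / 2) = s at *
        generalize Real.exp ((a j - L₀) / 2) = r at *
        rw [h4, h5] at h1 ⊢
        nlinarith [sq_nonneg ((s + r) * (b i - a j) / 2 - (s - r)),
          mul_nonneg (sq_nonneg (s - r)) (sq_nonneg (b i - a j))]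
      have := mul_le_mul_of_nonneg_left key (hw i j)
      linarith
    simp only [Finset.sum_sub_distrib, Finset.sum_add_distrib, ← Finset.mul_sum,
      ← Finset.sum_div] at h
    rw [hwp, hwq, ← hG] at h
    linarith

/-! ### Spectral estimates for Hermitian matrices -/

section Hermitian

variable {n : Type*} [Fintype n] [DecidableEq n]

lemma Matrix.IsHermitian.re_trace_exp {A : Matrix n n ℂ} (hA : A.IsHermitian) :
    (Matrix.trace (NormedSpace.exp A)).re = ∑ i, Real.exp (hA.eigenvalues i) := by
  have h1 : A = (Unitary.toUnits hA.eigenvectorUnitary : Matrix n n ℂ) *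
      Matrix.diagonal (RCLike.ofReal ∘ hA.eigenvalues) *
      (↑((Unitary.toUnits hA.eigenvectorUnitary)⁻¹ : (Matrix n n ℂ)ˣ) : Matrix n n ℂ) := by
    conv_lhs => rw [hA.spectral_theorem]
    rfl
  conv_lhs => rw [h1, Matrix.exp_units_conj, Matrix.trace_units_conj, Matrix.exp_diagonal]
  rw [Matrix.trace_diagonal, Complex.re_sum]
  refine Finset.sum_congr rfl fun i _ => ?_
  rw [Pi.coe_exp, Function.comp_apply, ← Complex.exp_eq_exp_ℂ]
  exact Complex.exp_ofReal_re _

lemma Matrix.IsHermitian.toEuclideanCLM_eigenvectorBasis {A : Matrix n n ℂ} (hA : A.IsHermitian)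
    (j : n) : Matrix.toEuclideanCLM (𝕜 := ℂ) A (hA.eigenvectorBasis j) =
      (hA.eigenvalues j : ℂ) • hA.eigenvectorBasis j := by
  ext i
  rw [Matrix.ofLp_toEuclideanCLM, hA.mulVec_eigenvectorBasis]
  simp

lemma Matrix.IsHermitian.inner_toEuclideanCLM_left {A : Matrix n n ℂ} (hA : A.IsHermitian)
    (x y : EuclideanSpace ℂ n) : inner ℂ (Matrix.toEuclideanCLM (𝕜 := ℂ) A x) y =
      inner ℂ x (Matrix.toEuclideanCLM (𝕜 := ℂ) A y) :=
  Matrix.isSymmetric_toEuclideanLin_iff.2 hA x y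

/-- The free energy of a Hermitian matrix is controlled in a Hermitian direction `B` by its slope,
the Gibbs expectation of `B`. -/
lemma exists_slope_log_trace_exp [Nonempty n] {A B : Matrix n n ℂ} (hA : A.IsHermitian)
    (hB : B.IsHermitian) {M : ℝ} (hM : ‖Matrix.toEuclideanCLM (𝕜 := ℂ) B‖ ≤ M) :
    ∃ g : ℝ, |g| ≤ M ∧ ∀ x : ℝ,
      Real.log (Matrix.trace (NormedSpace.exp A)).re + x * g ≤
        Real.log (Matrix.trace (NormedSpace.exp (A + (x : ℂ) • B))).re ∧
      Real.log (Matrix.trace (NormedSpace.exp (A + (x : ℂ) • B))).re ≤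
        Real.log (Matrix.trace (NormedSpace.exp A)).re + x * g + 4 * x ^ 2 * M ^ 2 := by
  set v := hA.eigenvectorBasis with hv
  set a := hA.eigenvalues with ha
  set β := Matrix.toEuclideanCLM (𝕜 := ℂ) B with hβ
  have hβn : ∀ u : EuclideanSpace ℂ n, ‖u‖ = 1 → ‖β u‖ ≤ M := fun u hu =>
    (β.le_opNorm u).trans (by rw [hu, mul_one]; exact hM)
  have hq : ∑ j, Real.exp (a j - Real.log (∑ j, Real.exp (a j))) = 1 := by
    have hpos : 0 < ∑ j, Real.exp (a j) :=
      Finset.sum_pos (fun j _ => Real.exp_pos _) Finset.univ_nonempty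
    simp_rw [Real.exp_sub, ← Finset.sum_div]
    rw [Real.exp_log hpos, div_self hpos.ne']
  refine ⟨∑ j, Real.exp (a j - Real.log (∑ j, Real.exp (a j))) * (inner ℂ (v j) (β (v j))).re,
    ?_, fun x => ?_⟩
  · refine (Finset.abs_sum_le_sum_abs _ _).trans ?_
    calc _ ≤ ∑ j, Real.exp (a j - Real.log (∑ j, Real.exp (a j))) * M := by
          refine Finset.sum_le_sum fun j _ => ?_
          rw [abs_mul, abs_of_pos (Real.exp_pos _)]
          refine mul_le_mul_of_nonneg_left ?_ (Real.exp_pos _).le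
          refine (Complex.abs_re_le_norm _).trans ((norm_inner_le_norm _ _).trans ?_)
          rw [v.norm_eq_one, one_mul]
          exact hβn _ (v.norm_eq_one j)
      _ = M := by rw [← Finset.sum_mul, hq, one_mul]
  · have hxB : ((x : ℂ) • B).IsHermitian := by
      rw [Matrix.IsHermitian, Matrix.conjTranspose_smul, hB.eq]
      simp
    have hAB := hA.add hxB
    set u := hAB.eigenvectorBasis with hu
    set b := hAB.eigenvalues with hb
    rw [hA.re_trace_exp, hAB.re_trace_exp]
    -- The matrix element of `(A + xB) - A` between eigenvectors of the two operators. Hence the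
    -- second moments of `b i - a j` under the overlaps are, by Parseval, squared norms of `xB` on
    -- unit vectors.
    have hshift : ∀ i j, inner ℂ (u i) ((x : ℂ) • β (v j)) =
        ((b i - a j : ℝ) : ℂ) * inner ℂ (u i) (v j) := by
      intro i j
      have h1 : (x : ℂ) • β (v j) =
          Matrix.toEuclideanCLM (𝕜 := ℂ) (A + (x : ℂ) • B) (v j) - (a j : ℂ) • v j := by
        rw [map_add, map_smul, ← hA.toEuclideanCLM_eigenvectorBasis j]
        simp [hβ, hv]
      rw [h1, inner_sub_right, ← hAB.inner_toEuclideanCLM_left,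
        hAB.toEuclideanCLM_eigenvectorBasis i, inner_smul_left, inner_smul_right]
      simp
      ring
    have hsq : ∀ i j, ‖inner ℂ (u i) (v j)‖ ^ 2 * (b i - a j) ^ 2 =
        ‖inner ℂ (u i) ((x : ℂ) • β (v j))‖ ^ 2 := by
      intro i j
      rw [hshift, norm_mul, Complex.norm_real, mul_pow, Real.norm_eq_abs, sq_abs, mul_comm]
    have hnorm : ∀ z : EuclideanSpace ℂ n, ‖z‖ = 1 → ‖(x : ℂ) • β z‖ ^ 2 ≤ x ^ 2 * M ^ 2 := by
      intro z hz
      rw [norm_smul, Complex.norm_real, mul_pow, Real.norm_eq_abs, sq_abs]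
      exact mul_le_mul_of_nonneg_left
        (pow_le_pow_left₀ (norm_nonneg _) (hβn z hz) 2) (sq_nonneg x)
    have hmain := log_sum_exp_bounds (w := fun i j => ‖inner ℂ (u i) (v j)‖ ^ 2) (a := a) (b := b)
      (K := x ^ 2 * M ^ 2) (fun _ _ => sq_nonneg _)
      (fun i => by rw [v.sum_sq_norm_inner_left, u.norm_eq_one, one_pow])
      (fun j => by rw [u.sum_sq_norm_inner_right, v.norm_eq_one, one_pow])
      (fun i => by
        have h1 : ∀ j, inner ℂ (u i) ((x : ℂ) • β (v j)) = inner ℂ ((x : ℂ) • β (u i)) (v j) := by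
          intro j
          rw [inner_smul_left, inner_smul_right, hB.inner_toEuclideanCLM_left, Complex.conj_ofReal]
        simp_rw [hsq, h1]
        rw [v.sum_sq_norm_inner_left]
        exact hnorm _ (u.norm_eq_one i))
      (fun j => by
        simp_rw [hsq]
        rw [u.sum_sq_norm_inner_right]
        exact hnorm _ (v.norm_eq_one j))
    have hG : ∀ j, ∑ i, ‖inner ℂ (u i) (v j)‖ ^ 2 * (b i - a j) =
        x * (inner ℂ (v j) (β (v j))).re := by
      intro j
      have h1 := congrArg Complex.re (u.sum_inner_mul_inner (v j) ((x : ℂ) • β (v j)))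
      rw [inner_smul_right, Complex.re_ofReal_mul, Complex.re_sum] at h1
      rw [← h1]
      refine Finset.sum_congr rfl fun i _ => ?_
      rw [hshift, mul_left_comm, Complex.re_ofReal_mul, ← RCLike.re_eq_complex_re,
        inner_mul_symm_re_eq_norm, norm_mul, norm_inner_symm, ← sq, mul_comm]
    have hG' : ∑ j, Real.exp (a j - Real.log (∑ j, Real.exp (a j))) *
        ∑ i, ‖inner ℂ (u i) (v j)‖ ^ 2 * (b i - a j) =
        x * ∑ j, Real.exp (a j - Real.log (∑ j, Real.exp (a j))) *
          (inner ℂ (v j) (β (v j))).re := by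
      rw [Finset.mul_sum]
      exact Finset.sum_congr rfl fun j _ => by rw [hG]; ring
    simp only [hG'] at hmain
    refine ⟨hmain.1, hmain.2.trans ?_⟩
    nlinarith [mul_nonneg (sq_nonneg x) (sq_nonneg M)]

end Hermitian

lemma hasQuadraticSlopes_log_trace_exp {n : Type*} [Fintype n] [DecidableEq n] [Nonempty n]
    {T : Type*} [Fintype T] [DecidableEq T] {φ : T → Matrix n n ℂ} {M : T → ℝ}
    (hφ : ∀ t, (φ t).IsHermitian) (hφM : ∀ t, ‖Matrix.toEuclideanCLM (𝕜 := ℂ) (φ t)‖ ≤ M t) :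
    HasQuadraticSlopes
      (fun y => Real.log (Matrix.trace (NormedSpace.exp (∑ t, (y t : ℂ) • φ t))).re) M := by
  intro y k
  have hH : (∑ t, (y t : ℂ) • φ t).IsHermitian := by
    rw [Matrix.IsHermitian, Matrix.conjTranspose_sum]
    refine Finset.sum_congr rfl fun t _ => ?_
    rw [Matrix.conjTranspose_smul, (hφ t).eq]
    simp
  obtain ⟨g, hg, hgx⟩ := exists_slope_log_trace_exp hH (hφ k) (hφM k)
  have hadd : ∀ x : ℝ, ∑ t, (((y + Pi.single k x : T → ℝ) t : ℝ) : ℂ) • φ t =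
      ∑ t, (y t : ℂ) • φ t + (x : ℂ) • φ k := by
    intro x
    simp only [Pi.add_apply, Complex.ofReal_add, add_smul, Finset.sum_add_distrib]
    congr 1
    rw [Finset.sum_eq_single k (fun t _ ht => by simp [ht]) (by simp)]
    simp
  refine ⟨g, hg, fun x => ?_⟩
  simp only [hadd]
  exact hgx x

/-- The operator norm of `A ⊗ 1`. -/
lemma norm_toEuclideanCLM_prod_le {n m k : Type*} [Fintype n] [Fintype m] [Fintype k]
    [DecidableEq n] [DecidableEq m] [DecidableEq k] (e : n ≃ m × k) {A : Matrix m m ℂ}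
    {B : Matrix n n ℂ}
    (hB : ∀ s t, B s t = if (e s).2 = (e t).2 then A (e s).1 (e t).1 else 0) :
    ‖Matrix.toEuclideanCLM (𝕜 := ℂ) B‖ ≤ ‖Matrix.toEuclideanCLM (𝕜 := ℂ) A‖ := by
  refine ContinuousLinearMap.opNorm_le_bound _ (norm_nonneg _) fun v => ?_
  refine le_of_sq_le_sq ?_ (by positivity)
  -- With the second component frozen at `r`, `B` acts on the slice as `A`, and squared norms add
  -- over the slices.
  let slice : k → EuclideanSpace ℂ m := fun r => WithLp.toLp 2 fun p => v (e.symm (p, r))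
  have hnorm : ∀ z : EuclideanSpace ℂ n, ‖z‖ ^ 2 = ∑ r, ∑ p, ‖z (e.symm (p, r))‖ ^ 2 := by
    intro z
    rw [EuclideanSpace.norm_sq_eq,
      ← Fintype.sum_prod_type_right' fun p r => ‖z (e.symm (p, r))‖ ^ 2]
    exact (Equiv.sum_comp e.symm fun s => ‖z s‖ ^ 2).symm
  have hap : ∀ p r, Matrix.toEuclideanCLM (𝕜 := ℂ) B v (e.symm (p, r)) =
      Matrix.toEuclideanCLM (𝕜 := ℂ) A (slice r) p := by
    intro p r
    rw [Matrix.ofLp_toEuclideanCLM, Matrix.ofLp_toEuclideanCLM, Matrix.mulVec, Matrix.mulVec,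
      dotProduct, dotProduct, ← Equiv.sum_comp e.symm, Fintype.sum_prod_type]
    refine Finset.sum_congr rfl fun q _ => ?_
    rw [Finset.sum_eq_single r]
    · simp [hB, slice]
    · intro r' _ hr'
      simp [hB, hr'.symm]
    · simp
  rw [mul_pow, hnorm, hnorm, Finset.mul_sum]
  refine Finset.sum_le_sum fun r _ => ?_
  simp_rw [hap]
  have h1 := (Matrix.toEuclideanCLM (𝕜 := ℂ) A).le_opNorm (slice r)
  have h2 := pow_le_pow_left₀ (norm_nonneg _) h1 2
  rwa [mul_pow, EuclideanSpace.norm_sq_eq, EuclideanSpace.norm_sq_eq] at h2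

/-- A relabelling is the case of a one-point second factor; applying the inequality to `e` and to
its inverse gives equality. -/
lemma norm_toEuclideanCLM_submatrix {n m : Type*} [Fintype n] [Fintype m]
    [DecidableEq n] [DecidableEq m] (e : n ≃ m) (A : Matrix m m ℂ) :
    ‖Matrix.toEuclideanCLM (𝕜 := ℂ) (A.submatrix e e)‖ = ‖Matrix.toEuclideanCLM (𝕜 := ℂ) A‖ :=
  le_antisymm
    (norm_toEuclideanCLM_prod_le (k := Unit) (e.trans (Equiv.prodUnique m Unit).symm)
      fun s t => by simp)
    (norm_toEuclideanCLM_prod_le (k := Unit) (e.symm.trans (Equiv.prodUnique n Unit).symm)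
      fun s t => by simp)

/-- A configuration on `Λ` is a configuration on `X ⊆ Λ` together with one on `Λ ∖ X`. -/
def restrictEquiv {d : ℕ} {α : Type*} {X Λ : Finset (Site d)} (h : X ⊆ Λ) :
    (Λ → α) ≃ (X → α) × ({i : Λ // i.1 ∉ X} → α) where
  toFun s := (Finset.restrict₂ (π := fun _ => α) h s, fun i => s i.1)
  invFun p i := if hi : i.1 ∈ X then p.1 ⟨i.1, hi⟩ else p.2 ⟨i, hi⟩
  left_inv s := by
    ext i
    by_cases hi : i.1 ∈ X <;> simp [hi, Finset.restrict₂]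
  right_inv p := by
    ext i
    · simp [Finset.restrict₂]
    · simp [i.2]

lemma LocalOperator.isHermitian_extend {d : ℕ} {κ : Type*} [DecidableEq κ]
    {X Λ : Finset (Site d)} (h : X ⊆ Λ) {A : LocalOperator κ X} (hA : A.IsHermitian) :
    (A.extend h).IsHermitian := by
  refine Matrix.IsHermitian.ext fun s t => ?_
  simp only [LocalOperator.extend, Matrix.of_apply]
  by_cases hst : ∀ i : Λ, i.1 ∉ X → s i = t i
  · rw [if_pos hst, if_pos fun i hi => (hst i hi).symm, hA.apply]
  · rw [if_neg hst, if_neg fun hts => hst fun i hi => (hts i hi).symm, star_zero]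

lemma LocalOperator.norm_extend_le {d : ℕ} {κ : Type*} [Fintype κ] [DecidableEq κ]
    {X Λ : Finset (Site d)} (h : X ⊆ Λ) (A : LocalOperator κ X) :
    ‖Matrix.toEuclideanCLM (𝕜 := ℂ) (A.extend h)‖ ≤ ‖Matrix.toEuclideanCLM (𝕜 := ℂ) A‖ :=
  norm_toEuclideanCLM_prod_le (restrictEquiv h) fun s t => by
    simp only [LocalOperator.extend, Matrix.of_apply, restrictEquiv, Equiv.coe_fn_mk]
    refine if_congr ?_ rfl rfl
    simp [funext_iff]

namespace QuantumPotential

variable {d : ℕ} {κ : Type*} [Fintype κ] [DecidableEq κ] {ι : Type*} {Ω : Type*}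
  [MeasurableSpace Ω] {Pr : Measure Ω}

lemma isWeight_normΦ (U : QuantumPotential d κ ι Pr) : U.IsWeight U.normΦ where
  empty j hj := by
    rw [normΦ, U.Φ_empty j hj, map_zero, ← ofReal_norm, norm_zero, ENNReal.ofReal_zero]
  translate a X j hj := by
    have h := norm_toEuclideanCLM_submatrix (pullbackEquiv a X) (U.Φ X j)
    rw [normΦ, normΦ, U.Φ_translate a X j hj, ← ofReal_norm, ← ofReal_norm, ← h]
    rfl
  ne_top X j _ := enorm_ne_top

/-- The interaction terms inside `Λ`, as operators on `ℋ_Λ`. -/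
def term (U : QuantumPotential d κ ι Pr) {Λ : Finset (Site d)} (t : U.Terms Λ) :
    LocalOperator κ Λ :=
  (U.Φ t.1.1 t.2.1).extend (Finset.mem_powerset.1 t.1.2)

lemma potential_eq_sum_term (U : QuantumPotential d κ ι Pr) (Λ : Finset (Site d)) (ω : Ω) :
    U.potential Λ ω = ∑ t : U.Terms Λ, (U.J t.1.1 t.2.1 ω : ℂ) • U.term t :=
  (U.sum_terms Λ fun X j => (U.J X.1 j ω : ℂ) •
    (U.Φ X.1 j).extend (Finset.mem_powerset.1 X.2)).symm

lemma isHermitian_term (U : QuantumPotential d κ ι Pr) {Λ : Finset (Site d)} (t : U.Terms Λ) :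
    (U.term t).IsHermitian :=
  LocalOperator.isHermitian_extend _ (U.isHermitian_Φ _ _ t.2.2)

lemma norm_term_le (U : QuantumPotential d κ ι Pr) {Λ : Finset (Site d)} (t : U.Terms Λ) :
    ‖Matrix.toEuclideanCLM (𝕜 := ℂ) (U.term t)‖ ≤ (U.normΦ t.1.1 t.2.1).toReal := by
  rw [normΦ, toReal_enorm]
  exact LocalOperator.norm_extend_le _ _

theorem IsStableDecomposition.integral_bounds [IsProbabilityMeasure Pr] [Nonempty κ]
    {ι₁ ι₂ : Type*} {U : QuantumPotential d κ ι Pr} {Ut : QuantumPotential d κ ι₁ Pr}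
    {Uh : QuantumPotential d κ ι₂ Pr} (h : U.IsStableDecomposition Ut Uh)
    (Λ : Finset (Site d)) :
    Integrable (fun ω => Real.log (U.partitionFunction Λ ω)) Pr ∧
    Λ.card * Real.log (Fintype.card κ) - Λ.card * Ut.norm1.toReal ≤ U.pressure Λ ∧
    U.pressure Λ ≤ Λ.card * Real.log (Fintype.card κ) + Λ.card * Ut.norm1.toReal +
      4 * (Λ.card * Uh.norm2.toReal ^ 2) := by
  classical
  have hf := hasQuadraticSlopes_log_trace_exp
    (φ := Sum.elim (Ut.term (Λ := Λ)) (Uh.term (Λ := Λ)))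
    (M := Sum.elim (fun t => (Ut.normΦ t.1.1 t.2.1).toReal)
      fun t => (Uh.normΦ t.1.1 t.2.1).toReal)
    (by
      rintro (t | t)
      exacts [Ut.isHermitian_term t, Uh.isHermitian_term t])
    (by
      rintro (t | t)
      exacts [Ut.norm_term_le t, Uh.norm_term_le t])
  have key := Couplings.integral_bounds Ut.isWeight_normΦ Uh.isWeight_normΦ h.indep h.zeroMean
    h.norm1_lt_top h.norm2_lt_top Λ hf
    (F := fun ω => Real.log (U.partitionFunction Λ ω))
    (by
      filter_upwards [h.eq_add Λ] with ω hω
      simp only [partitionFunction, hω, potential_eq_sum_term, Fintype.sum_sum_type, Sum.elim_inl,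
        Sum.elim_inr])
  -- With all couplings zero the trace is that of the identity, `|κ| ^ |Λ|`, which is the source of
  -- the term `|Λ| log |κ|`.
  simpa [pressure, norm1, norm2, NormedSpace.exp_zero, Matrix.trace_one, ← Complex.ofReal_natCast,
    ← Complex.ofReal_pow] using key

end QuantumPotential

/-- Two-sided extensive bounds on `P` bound `|P| / N`. -/
lemma abs_div_le_of_extensive_bounds {P N c s t : ℝ} (hN : 0 < N) (hc : 0 ≤ c)
    (ht : 0 ≤ t) (h₁ : N * c - N * s ≤ P) (h₂ : P ≤ N * c + N * s + 4 * (N * t)) :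
    |P / N| ≤ c + s + 4 * t := by
  rw [abs_le, le_div_iff₀ hN, div_le_iff₀ hN]
  constructor <;> nlinarith [mul_nonneg hN.le hc, mul_nonneg hN.le ht]

theorem theorem2 {d : ℕ} {Ω : Type*} [MeasurableSpace Ω] (Pr : Measure Ω)
    [IsProbabilityMeasure Pr] {ι ι₁ ι₂ : Type*} :
    -- the classical case
    (∀ {S : Type*} [MeasurableSpace S] (μ : Measure S) [IsProbabilityMeasure μ]
        (U : ClassicalPotential d μ ι Pr) (Ut : ClassicalPotential d μ ι₁ Pr)
        (Uh : ClassicalPotential d μ ι₂ Pr),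
      U.IsStableDecomposition Ut Uh →
        (∀ Λ : Finset (Site d),
          Integrable (fun ω => Real.log (U.partitionFunction Λ ω)) Pr ∧
          U.pressure Λ ≤ (Λ.card : ℝ) * (Ut.norm1.toReal + 4 * Uh.norm2.toReal ^ 2)) ∧
        ∃ C : ℝ, ∀ Λ : Finset (Site d), Λ.Nonempty → |U.specificPressure Λ| ≤ C) ∧
    -- the quantum case
    (∀ {κ : Type*} [Fintype κ] [DecidableEq κ] [Nonempty κ]
        (U : QuantumPotential d κ ι Pr) (Ut : QuantumPotential d κ ι₁ Pr)
        (Uh : QuantumPotential d κ ι₂ Pr),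
      U.IsStableDecomposition Ut Uh →
        (∀ Λ : Finset (Site d),
          Integrable (fun ω => Real.log (U.partitionFunction Λ ω)) Pr ∧
          U.pressure Λ ≤ (Λ.card : ℝ) *
            (Real.log (Fintype.card κ) + Ut.norm1.toReal + 4 * Uh.norm2.toReal ^ 2)) ∧
        ∃ C : ℝ, ∀ Λ : Finset (Site d), Λ.Nonempty → |U.specificPressure Λ| ≤ C) := by

  constructor
  · intro S _ μ _ U Ut Uh h
    refine ⟨fun Λ => ?_, Ut.norm1.toReal + 4 * Uh.norm2.toReal ^ 2, fun Λ hΛ => ?_⟩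
    · have hb := h.integral_bounds Λ
      exact ⟨hb.1, by linarith [hb.2.2]⟩
    · have hb := h.integral_bounds Λ
      have hN : (0 : ℝ) < Λ.card := Nat.cast_pos.2 hΛ.card_pos
      have := abs_div_le_of_extensive_bounds (P := U.pressure Λ) (c := 0)
        (s := Ut.norm1.toReal) hN le_rfl
        (sq_nonneg Uh.norm2.toReal) (by linarith [hb.2.1]) (by linarith [hb.2.2])
      rwa [zero_add] at this
  · intro κ _ _ _ U Ut Uh h
    refine ⟨fun Λ => ?_,
      Real.log (Fintype.card κ) + Ut.norm1.toReal + 4 * Uh.norm2.toReal ^ 2, fun Λ hΛ => ?_⟩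
    · have hb := h.integral_bounds Λ
      exact ⟨hb.1, by linarith [hb.2.2]⟩
    · have hb := h.integral_bounds Λ
      exact abs_div_le_of_extensive_bounds (Nat.cast_pos.2 hΛ.card_pos)
        (Real.log_natCast_nonneg _) (sq_nonneg _) hb.2.1 hb.2.2
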